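/- Identify the Euclidean $4$-space $E^4$ with the quaternions, the point $(x_0,x_1,x_2,x_3)$ corresponding to $x_0+x_1\mathbf i+x_2\mathbf j+x_3\mathbf k$. To a straight line $\ell\subset E^4$ orthogonal to the $x_0$-direction assign the point $(\mathfrak l:\mathfrak m)$ of the real projective space $P^5$, where the pure quaternion $\mathfrak l\neq 0$ is a direction vector of $\ell$ and $\mathfrak m=\widetilde{\mathfrak l}\circ\mathfrak F$ is the (pure) product of the conjugate of $\mathfrak l$ with the pedal point $\mathfrak F$ of $\ell$ with respect to the origin. Let $\ell_1,\ell_2$ be two lines of $E^4$ orthogonal to the $x_0$-direction which are skew, i.e. which span a $3$-space, and let $g\subset P^5$ be the straight line joining their points. Then every point of $g$ is the point of exactly one line of $E^4$ orthogonal to the $x_0$-direction. Let $\Gamma\subset E^4$ be the union of the lines corresponding to the points of $g$. Then: 1. $\Gamma$ is a conoidal $2$-surface with respect to the director hyperplane $x_0=0$; that is, $\Gamma=\{\mathbf s(t)+u\,\mathbf r(t) : t,u\in\mathbb R\}$ with smooth $\mathbf s,\mathbf r:\mathbb R\to\mathbb R^4$ such that the two partial derivatives of $\mathbf s(t)+u\,\mathbf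 r(t)$ are linearly independent for all $t,u$ and all rulings are parallel to the hyperplane $x_0=0$, i.e. the $x_0$-coordinate of $\mathbf r$ is $0$. 2. $\Gamma$ is cubic; that is, its projective closure (the Zariski closure of $\Gamma$ in the complex projective $4$-space) is of dimension $2$ and of degree $3$: a general plane of the complex projective $4$-space meets it in exactly $3$ points. -/

import Mathlib

open scoped Quaternion ContDiff LinearAlgebra.Projectivization

/-! The Euclidean 4-space is modelled on the quaternions `ℍ[ℝ]` with their Euclidean norm; the point
with Cartesian coordinates `(x₀, x₁, x₂, x₃)` is the quaternion `x₀ + x₁ i + x₂ j + x₃ k`. -/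

/-- The pure quaternions, i.e. the hyperplane `x₀ = 0` of the Euclidean 4-space. -/
def pureQuaternions : Submodule ℝ ℍ[ℝ] where
  carrier := {q | q.re = 0}
  zero_mem' := by simp
  add_mem' := by
    intro a b (ha : a.re = 0) (hb : b.re = 0)
    change (a + b).re = 0
    simp [ha, hb]
  smul_mem' := by
    intro c a (ha : a.re = 0)
    change (c • a).re = 0
    simp [ha]

/-- The straight lines of the Euclidean 4-space which are orthogonal to the `x₀`-direction. -/
structure OrthLine where
  /-- The line as an affine subspace. -/
  line : AffineSubspace ℝ ℍ[ℝ]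
  finrank_direction : Module.finrank ℝ line.direction = 1
  direction_le : line.direction ≤ pureQuaternions

namespace OrthLine

theorem nonempty_line (ℓ : OrthLine) : Nonempty ℓ.line := by
  by_contra h
  have hb : ℓ.line = ⊥ := by
    rw [← AffineSubspace.coe_eq_bot_iff, ← Set.not_nonempty_iff_eq_empty]
    rintro ⟨x, hx⟩
    exact h ⟨⟨x, hx⟩⟩
  have h1 := ℓ.finrank_direction
  rw [hb, AffineSubspace.direction_bot, finrank_bot] at h1
  exact zero_ne_one h1

instance (ℓ : OrthLine) : Nonempty ℓ.line := ℓ.nonempty_line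

theorem exists_direction (ℓ : OrthLine) : ∃ l : ℍ[ℝ], l ∈ ℓ.line.direction ∧ l ≠ 0 := by
  have h : ℓ.line.direction ≠ ⊥ := by
    intro h
    have h1 := ℓ.finrank_direction
    rw [h] at h1
    simp at h1
  exact ℓ.line.direction.ne_bot_iff.mp h

/-- A direction vector of the line (any one: it is determined up to a nonzero real factor). -/
noncomputable def dir (ℓ : OrthLine) : ℍ[ℝ] := ℓ.exists_direction.choose

theorem dir_mem (ℓ : OrthLine) : ℓ.dir ∈ ℓ.line.direction := ℓ.exists_direction.choose_spec.1

theorem dir_ne_zero (ℓ : OrthLine) : ℓ.dir ≠ 0 := ℓ.exists_direction.choose_spec.2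

/-- The pedal point of the line with respect to the origin. -/
noncomputable def pedalPoint (ℓ : OrthLine) : ℍ[ℝ] :=
  (EuclideanGeometry.orthogonalProjection ℓ.line 0 : ℍ[ℝ])

theorem star_dir_mul_pedalPoint_mem (ℓ : OrthLine) :
    star ℓ.dir * ℓ.pedalPoint ∈ pureQuaternions := by
  have h := EuclideanGeometry.vsub_orthogonalProjection_mem_direction_orthogonal ℓ.line 0
  have h2 := (Submodule.mem_orthogonal _ _).mp h ℓ.dir ℓ.dir_mem
  simp only [vsub_eq_sub, zero_sub, inner_neg_right, neg_eq_zero] at h2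
  change inner ℝ ℓ.dir ℓ.pedalPoint = 0 at h2
  rw [Quaternion.inner_def] at h2
  change (star ℓ.dir * ℓ.pedalPoint).re = 0
  simp only [Quaternion.re_mul, Quaternion.re_star, Quaternion.imI_star, Quaternion.imJ_star,
    Quaternion.imK_star] at h2 ⊢
  linarith

end OrthLine

/-- The real projective 5-space, with homogeneous coordinates `(l, m)`, where `l` and `m` are pure
quaternions. -/
abbrev ProjFive : Type := ℙ ℝ (pureQuaternions × pureQuaternions)

/-- The point `(l, m)ℝ` of the projective 5-space given by the homogeneous minimal coordinates of a
line: `l` is a direction vector, and `m = l̃ ∘ F` with the pedal point `F`. -/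
noncomputable def OrthLine.toProjFive (ℓ : OrthLine) : ProjFive :=
  Projectivization.mk ℝ
    ((⟨ℓ.dir, ℓ.direction_le ℓ.dir_mem⟩,
      ⟨star ℓ.dir * ℓ.pedalPoint, ℓ.star_dir_mul_pedalPoint_mem⟩) :
        pureQuaternions × pureQuaternions)
    (fun h => ℓ.dir_ne_zero (congrArg Subtype.val (congrArg Prod.fst h)))

/-- Two lines are skew if they span a 3-space. -/
def OrthLine.Skew (ℓ₁ ℓ₂ : OrthLine) : Prop :=
  Module.finrank ℝ (ℓ₁.line ⊔ ℓ₂.line).direction = 3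

/-- The straight line of the projective 5-space joining the points of `ℓ₁` and `ℓ₂`. -/
noncomputable def joinLine (ℓ₁ ℓ₂ : OrthLine) :
    Projectivization.Subspace ℝ (pureQuaternions × pureQuaternions) :=
  Projectivization.Subspace.span {ℓ₁.toProjFive, ℓ₂.toProjFive}

/-- The subset of the Euclidean 4-space swept by all lines whose points lie in a subspace `g` of the
projective 5-space. -/
def correspondingSet (g : Projectivization.Subspace ℝ (pureQuaternions × pureQuaternions)) :
    Set ℍ[ℝ] :=
  {x | ∃ ℓ : OrthLine, ℓ.toProjFive ∈ g ∧ x ∈ ℓ.line}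

/-- `Γ` is a conoidal 2-surface with respect to the director hyperplane `D`: it is generated by a
smooth one-parametric set of straight lines `u ↦ s t + u • r t`, all of them parallel to `D`, such
that `(t, u) ↦ s t + u • r t` is regular (its two partial derivatives are always linearly
independent). -/
def IsConoidalSurface (Γ : Set ℍ[ℝ]) (D : Submodule ℝ ℍ[ℝ]) : Prop :=
  ∃ s r : ℝ → ℍ[ℝ], ContDiff ℝ ∞ s ∧ ContDiff ℝ ∞ r ∧
    (∀ t u : ℝ, LinearIndependent ℝ ![deriv s t + u • deriv r t, r t]) ∧
    (∀ t : ℝ, r t ∈ D) ∧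
    Γ = {x | ∃ t u : ℝ, x = s t + u • r t}

/-- The point `(1 : x₀ : x₁ : x₂ : x₃)` of the complex projective 4-space given by a point of the
Euclidean 4-space; the first coordinate is the homogenizing one. -/
noncomputable def toProjFour (x : ℍ[ℝ]) : ℙ ℂ (Fin (4 + 1) → ℂ) :=
  Projectivization.mk ℂ ![1, (x.re : ℂ), (x.imI : ℂ), (x.imJ : ℂ), (x.imK : ℂ)]
    (fun h => one_ne_zero (congrFun h 0))

/-- The Zariski closure of a subset of the complex projective `n`-space: the common zeros of all
homogeneous polynomials which vanish on the set. -/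
def zariskiClosure {n : ℕ} (S : Set (ℙ ℂ (Fin (n + 1) → ℂ))) : Set (ℙ ℂ (Fin (n + 1) → ℂ)) :=
  {p | ∀ (d : ℕ) (f : MvPolynomial (Fin (n + 1)) ℂ), f.IsHomogeneous d →
    (∀ q ∈ S, MvPolynomial.eval q.rep f = 0) → MvPolynomial.eval p.rep f = 0}

/-- The projective closure of a subset of the Euclidean 4-space. -/
def projectiveClosure (Γ : Set ℍ[ℝ]) : Set (ℙ ℂ (Fin (4 + 1) → ℂ)) :=
  zariskiClosure (toProjFour '' Γ)

/-- The algebraic set `X` has dimension `k` and degree `e` (where `0 < e`): it has exactly `e` points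
in common with a general linear subspace of codimension `k`. The subspace is `A v = 0` with `A` of
rank `k`, and "general" means that some fixed nonzero polynomial does not vanish at the entries of
`A`. (A general subspace meets `X` transversally, so that all intersection multiplicities are 1.) -/
def HasDimAndDegree {n : ℕ} (X : Set (ℙ ℂ (Fin (n + 1) → ℂ))) (k e : ℕ) : Prop :=
  ∃ Q : MvPolynomial (Fin k × Fin (n + 1)) ℂ, Q ≠ 0 ∧
    ∀ A : Matrix (Fin k) (Fin (n + 1)) ℂ,
      LinearIndependent ℂ A.row → MvPolynomial.eval (fun ij => A ij.1 ij.2) Q ≠ 0 →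
        {p | p ∈ X ∧ A.mulVec p.rep = 0}.encard = e

/-! Gram–Schmidt on the direction components gives a basis (L, A), (M, B) of the 2-space behind g
with L, M orthonormal pure quaternions. The direction component then vanishes on no nonzero vector,
so every point of g comes from a unique line. The point with parameters (cos t, sin t) has direction
cos t L + sin t M and pedal point (cos t L + sin t M)(cos t A + sin t B) = S + cos 2t P + sin 2t R,
where S = (LA + MB)/2, P = (LA - MB)/2, R = (LB + MA)/2. This is the set `ellipseConoid`.

Skewness makes P, R, L, M independent: left multiplication by LM is a complex structure sending L to
M and P to R. So either P lies in span(L, M), which then contains R too and forces all rulings into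
one plane, or span(P, R) and span(L, M) are complementary (`linearIndependent_of_notMem_span`).
Independence yields regularity directly.

For the degree, put α = x + iy, β = x - iy with (x, y) proportional to (cos t, sin t). In a suitable
complex basis the projective closure is the cubic scroll (sαβ, sα², sβ², tα, tβ). It is cut out by
quadrics, and real parameters are Zariski dense in it. A plane imposes two equations s qᵢ + t mᵢ =
0, with qᵢ quadratic and mᵢ linear in α/β; the rulings it meets are the roots of the cubic q₀m₁ -
q₁m₀, three in general (`hasDimAndDegree_scroll`). -/

theorem MvPolynomial.IsHomogeneous.eval_smul_eq_pow_mul {σ R : Type*} [CommRing R] {f : MvPolynomial σ R}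
    {d : ℕ} (hf : f.IsHomogeneous d) (c : R) (v : σ → R) :
    MvPolynomial.eval (c • v) f = c ^ d * MvPolynomial.eval v f := by
  rw [MvPolynomial.eval_eq, MvPolynomial.eval_eq, Finset.mul_sum]
  refine Finset.sum_congr rfl fun m hm => ?_
  have h : ∑ i ∈ m.support, m i = d := by
    have := hf (MvPolynomial.mem_support_iff.mp hm)
    rwa [Finsupp.weight_apply, Finsupp.sum, Finset.sum_congr rfl (g := m) (by simp)] at this
  simp only [Pi.smul_apply, smul_eq_mul, mul_pow, Finset.prod_mul_distrib,
    Finset.prod_pow_eq_pow_sum, h]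
  ring

/-! ### The cubic scroll and its Zariski closure -/

/-- The points of the cubic scroll which is given, with respect to a basis, by the joining lines of
corresponding points of a conic and a straight line. -/
noncomputable def scrollPoint (b : Module.Basis (Fin 5) ℂ (Fin 5 → ℂ)) (α β s t : ℂ) :
    Fin 5 → ℂ :=
  (s * α * β) • b 0 + (s * α ^ 2) • b 1 + (s * β ^ 2) • b 2 + (t * α) • b 3 + (t * β) • b 4

namespace scrollPoint

variable (b : Module.Basis (Fin 5) ℂ (Fin 5 → ℂ)) (α β s t : ℂ)

theorem smul_eq (c : ℂ) : c • scrollPoint b α β s t = scrollPoint b α β (c * s) (c * t) := by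
  simp only [scrollPoint, smul_add, smul_smul]
  congr! 2 <;> ring_nf

theorem repr_apply (i : Fin 5) : b.repr (scrollPoint b α β s t) i =
    ![s * α * β, s * α ^ 2, s * β ^ 2, t * α, t * β] i := by
  have h (i j : Fin 5) : b.repr (b i) j = if i = j then 1 else 0 := by
    rw [b.repr_self, Finsupp.single_apply]
  simp only [scrollPoint, map_add, map_smul, Finsupp.add_apply, Finsupp.smul_apply, h, smul_eq_mul]
  fin_cases i <;> simp

theorem mulVec_apply {k : ℕ} (A : Matrix (Fin k) (Fin 5) ℂ) (i : Fin k) :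
    A.mulVec (scrollPoint b α β s t) i =
      s * α * β * A.mulVec (b 0) i + s * α ^ 2 * A.mulVec (b 1) i + s * β ^ 2 * A.mulVec (b 2) i +
        t * α * A.mulVec (b 3) i + t * β * A.mulVec (b 4) i := by
  simp [scrollPoint, Matrix.mulVec_add, Matrix.mulVec_smul]

end scrollPoint

/-- The equations are the 2 × 2 minors of the matrix with rows (x₁, x₀, x₃) and (x₀, x₂, x₄); on the
scroll these rows are α and β times a common row (sα, sβ, t). -/
theorem exists_eq_scrollPoint_iff (b : Module.Basis (Fin 5) ℂ (Fin 5 → ℂ)) (v : Fin 5 → ℂ) :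
    (∃ α β s t, v = scrollPoint b α β s t) ↔
      b.repr v 0 * b.repr v 0 = b.repr v 1 * b.repr v 2 ∧
      b.repr v 0 * b.repr v 4 = b.repr v 2 * b.repr v 3 ∧
      b.repr v 1 * b.repr v 4 = b.repr v 0 * b.repr v 3 := by
  constructor
  · rintro ⟨α, β, s, t, rfl⟩
    simp only [scrollPoint.repr_apply]
    refine ⟨?_, ?_, ?_⟩ <;> simp <;> ring
  · rintro ⟨h1, h2, h3⟩
    suffices h : ∃ α β s t, ∀ i, b.repr v i =
        ![s * α * β, s * α ^ 2, s * β ^ 2, t * α, t * β] i by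
      obtain ⟨α, β, s, t, h⟩ := h
      refine ⟨α, β, s, t, b.repr.injective (Finsupp.ext fun i => ?_)⟩
      rw [h, scrollPoint.repr_apply]
    generalize b.repr v = x at *
    simp only [Fin.forall_fin_succ]
    simp only [Matrix.cons_val]
    by_cases hz : x 1 = 0
    · have h0 : x 0 = 0 := by simpa [hz] using h1
      by_cases hw : x 2 = 0
      · exact ⟨x 3, x 4, 0, 1, by simp [h0, hz, hw]⟩
      · have hx : x 3 = 0 := by simpa [h0, hw] using h2
        exact ⟨0, 1, x 2, x 4, by simp [h0, hz, hx]⟩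
    -- The ratio α : β is x₁ : x₀; taking α = x₁ forces s = 1/x₁.
    · refine ⟨x 1, x 0, (x 1)⁻¹, x 3 / x 1, ?_⟩
      refine ⟨?_, ?_, ?_, ?_, ?_, fun i => i.elim0⟩
      · change x 0 = (x 1)⁻¹ * x 1 * x 0
        field_simp
      · change x 1 = (x 1)⁻¹ * x 1 ^ 2
        field_simp
      · change x 2 = (x 1)⁻¹ * x 0 ^ 2
        field_simp
        linear_combination -h1
      · change x 3 = x 3 / x 1 * x 1
        field_simp
      · change x 4 = x 3 / x 1 * x 0
        field_simp
        linear_combination h3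

/-- A linear form as a homogeneous polynomial. -/
noncomputable def linearFormPoly {n : ℕ} (φ : (Fin n → ℂ) →ₗ[ℂ] ℂ) : MvPolynomial (Fin n) ℂ :=
  ∑ i, MvPolynomial.C (φ (Pi.single i 1)) * MvPolynomial.X i

theorem linearFormPoly_isHomogeneous {n : ℕ} (φ : (Fin n → ℂ) →ₗ[ℂ] ℂ) :
    (linearFormPoly φ).IsHomogeneous 1 :=
  MvPolynomial.IsHomogeneous.sum _ _ _ fun i _ => by
    simpa using (MvPolynomial.isHomogeneous_C (Fin n) (φ (Pi.single i 1))).mul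
      (MvPolynomial.isHomogeneous_X ℂ i)

theorem eval_linearFormPoly {n : ℕ} (φ : (Fin n → ℂ) →ₗ[ℂ] ℂ) (v : Fin n → ℂ) :
    MvPolynomial.eval v (linearFormPoly φ) = φ v := by
  conv_rhs => rw [LinearMap.pi_apply_eq_sum_univ φ v]
  simp only [linearFormPoly, map_sum, map_mul, MvPolynomial.eval_C, MvPolynomial.eval_X,
    smul_eq_mul]
  refine Finset.sum_congr rfl fun i _ => ?_
  rw [mul_comm]
  congr 2
  ext j
  simp [Pi.single_apply, eq_comm]

theorem zariskiClosure_subset_scroll (b : Module.Basis (Fin 5) ℂ (Fin 5 → ℂ))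
    {S : Set (ℙ ℂ (Fin (4 + 1) → ℂ))}
    (hS : ∀ q ∈ S, ∃ α β s t, q.rep = scrollPoint b α β s t) {p : ℙ ℂ (Fin (4 + 1) → ℂ)}
    (hp : p ∈ zariskiClosure S) : ∃ α β s t, p.rep = scrollPoint b α β s t := by
  let c : Fin 5 → MvPolynomial (Fin 5) ℂ := fun i => linearFormPoly (b.coord i)
  have key (i j k l : Fin 5) (h : ∀ q ∈ S, b.repr q.rep i * b.repr q.rep j =
      b.repr q.rep k * b.repr q.rep l) : b.repr p.rep i * b.repr p.rep j =
      b.repr p.rep k * b.repr p.rep l := by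
    have := hp 2 (c i * c j - c k * c l)
      (((linearFormPoly_isHomogeneous _).mul (linearFormPoly_isHomogeneous _)).sub
        ((linearFormPoly_isHomogeneous _).mul (linearFormPoly_isHomogeneous _)))
      (fun q hq => by simpa [c, eval_linearFormPoly, sub_eq_zero] using h q hq)
    simpa [c, eval_linearFormPoly, sub_eq_zero] using this
  simp only [exists_eq_scrollPoint_iff] at hS ⊢
  exact ⟨key _ _ _ _ fun q hq => (hS q hq).1, key _ _ _ _ fun q hq => (hS q hq).2.1,
    key _ _ _ _ fun q hq => (hS q hq).2.2⟩

/-- Pulled back to the parameters (x, y, s, t), a form vanishing on `S` becomes a polynomial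
vanishing at almost all real points, hence identically, hence at all complex parameters. -/
theorem scroll_subset_zariskiClosure (b : Module.Basis (Fin 5) ℂ (Fin 5 → ℂ))
    {S : Set (ℙ ℂ (Fin (4 + 1) → ℂ))}
    (hS : ∀ x y s t : ℝ, x ^ 2 + y ^ 2 ≠ 0 → s ≠ 0 → ∃ q ∈ S, ∃ c : ℂ,
      scrollPoint b (x + y * Complex.I) (x - y * Complex.I) s t = c • q.rep)
    {p : ℙ ℂ (Fin (4 + 1) → ℂ)} (hp : ∃ α β s t, p.rep = scrollPoint b α β s t) :
    p ∈ zariskiClosure S := by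
  intro d f hf hfS
  open MvPolynomial in
  let α : MvPolynomial (Fin 4) ℂ := X 0 + X 1 * C Complex.I
  let β : MvPolynomial (Fin 4) ℂ := X 0 - X 1 * C Complex.I
  let Ψ : Fin 5 → MvPolynomial (Fin 4) ℂ := fun j =>
    (X 2 * α * β) * C (b 0 j) + (X 2 * α ^ 2) * C (b 1 j) + (X 2 * β ^ 2) * C (b 2 j) +
      (X 3 * α) * C (b 3 j) + (X 3 * β) * C (b 4 j)
  have hΨ (v : Fin 4 → ℂ) : eval v (bind₁ Ψ f) = eval (scrollPoint b
      (v 0 + v 1 * Complex.I) (v 0 - v 1 * Complex.I) (v 2) (v 3)) f := by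
    rw [← coe_aeval_eq_eval, ← coe_aeval_eq_eval]
    simp only [RingHom.coe_coe, aeval_bind₁]
    congr 2
    ext j
    simp [Ψ, α, β, scrollPoint]
  -- The extra factor kills the real parameters about which `hS` says nothing.
  have hzero : (X 0 ^ 2 + X 1 ^ 2) * X 2 * bind₁ Ψ f = 0 := by
    refine funext_set (fun _ => Set.range ((↑) : ℝ → ℂ))
      (fun _ => Set.infinite_range_of_injective Complex.ofReal_injective) fun v hv => ?_
    choose w hw using fun i => hv i trivial
    obtain rfl : v = fun i => (w i : ℂ) := funext fun i => (hw i).symm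
    simp only [map_mul, map_add, map_pow, eval_X, map_zero, hΨ]
    by_cases h1 : w 0 ^ 2 + w 1 ^ 2 = 0
    · norm_cast
      simp [h1]
    by_cases h2 : w 2 = 0
    · simp [h2]
    obtain ⟨q, hq, c, hc⟩ := hS (w 0) (w 1) (w 2) (w 3) h1 h2
    rw [hc, hf.eval_smul_eq_pow_mul, hfS q hq, mul_zero, mul_zero]
  have hne : (X 0 ^ 2 + X 1 ^ 2 : MvPolynomial (Fin 4) ℂ) * X 2 ≠ 0 := by
    intro h
    have := congrArg (eval ![1, 0, 1, 0]) h
    simp at this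
  have hb := (mul_eq_zero.mp hzero).resolve_left hne
  obtain ⟨α', β', s, t, h⟩ := hp
  -- These are the solutions x, y of x + iy = α', x - iy = β'.
  have := hΨ ![(α' + β') / 2, (β' - α') / 2 * Complex.I, s, t]
  rw [hb] at this
  have h1 : (α' + β') / 2 + (β' - α') / 2 * Complex.I * Complex.I = α' := by
    linear_combination (β' - α') / 2 * Complex.I_sq
  have h2 : (α' + β') / 2 - (β' - α') / 2 * Complex.I * Complex.I = β' := by
    linear_combination -(β' - α') / 2 * Complex.I_sq
  rw [h]
  simpa [h1, h2] using this.symm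

/-! ### Plane sections of the scroll -/

/-- The determinant `q₀ m₁ - q₁ m₀` of the system `s qᵢ(α) + t mᵢ(α) = 0`, where
`qᵢ = Nᵢ₁ α² + Nᵢ₀ α + Nᵢ₂` and `mᵢ = Nᵢ₃ α + Nᵢ₄`. -/
def pencilCubic {R : Type*} [CommRing R] (N : Fin 2 → Fin 5 → R) : Cubic R where
  a := N 0 1 * N 1 3 - N 0 3 * N 1 1
  b := N 0 1 * N 1 4 + N 0 0 * N 1 3 - N 1 1 * N 0 4 - N 1 0 * N 0 3
  c := N 0 0 * N 1 4 + N 0 2 * N 1 3 - N 1 0 * N 0 4 - N 1 2 * N 0 3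
  d := N 0 2 * N 1 4 - N 1 2 * N 0 4

theorem pencilCubic_eval {R : Type*} [CommRing R] (N : Fin 2 → Fin 5 → R) (x : R) :
    (pencilCubic N).a * x ^ 3 + (pencilCubic N).b * x ^ 2 + (pencilCubic N).c * x +
      (pencilCubic N).d =
    (N 0 1 * x ^ 2 + N 0 0 * x + N 0 2) * (N 1 3 * x + N 1 4) -
      (N 1 1 * x ^ 2 + N 1 0 * x + N 1 2) * (N 0 3 * x + N 0 4) := by
  simp only [pencilCubic]
  ring

/-- If both qᵢ and both mᵢ vanish at x, each product in q₀m₁ - q₁m₀ has a double zero there. -/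
theorem pencilCubic_discr_eq_zero {R : Type*} [CommRing R] (N : Fin 2 → Fin 5 → R) (x : R)
    (hq : ∀ i, N i 1 * x ^ 2 + N i 0 * x + N i 2 = 0) (hm : ∀ i, N i 3 * x + N i 4 = 0) :
    (pencilCubic N).discr = 0 := by
  have h2 (i) : N i 2 = -(N i 1 * x ^ 2 + N i 0 * x) := by linear_combination hq i
  have h4 (i) : N i 4 = -(N i 3 * x) := by linear_combination hm i
  simp only [Cubic.discr, pencilCubic, h2, h4]
  ring

/-- A polynomial in the entries of a `2 × 5` matrix, which does not vanish if the plane given by the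
matrix is in general position with respect to the scroll. -/
noncomputable def scrollGenericPoly (b : Module.Basis (Fin 5) ℂ (Fin 5 → ℂ)) :
    MvPolynomial (Fin 2 × Fin 5) ℂ :=
  let P := pencilCubic fun i j => ∑ k, MvPolynomial.X (i, k) * MvPolynomial.C (b j k)
  P.a * P.discr

theorem eval_scrollGenericPoly (b : Module.Basis (Fin 5) ℂ (Fin 5 → ℂ))
    (A : Matrix (Fin 2) (Fin 5) ℂ) :
    MvPolynomial.eval (fun ij => A ij.1 ij.2) (scrollGenericPoly b) =
      (pencilCubic fun i j => A.mulVec (b j) i).a *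
        (pencilCubic fun i j => A.mulVec (b j) i).discr := by
  have h (i : Fin 2) (j : Fin 5) : MvPolynomial.eval (fun ij : Fin 2 × Fin 5 => A ij.1 ij.2)
      (∑ k, MvPolynomial.X (i, k) * MvPolynomial.C (b j k)) = A.mulVec (b j) i := by
    simp [Matrix.mulVec, dotProduct]
  simp only [scrollGenericPoly, pencilCubic, Cubic.discr, map_mul, map_sub, map_add, map_pow,
    map_ofNat, h]

theorem scrollGenericPoly_ne_zero (b : Module.Basis (Fin 5) ℂ (Fin 5 → ℂ)) :
    scrollGenericPoly b ≠ 0 := by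
  intro h0
  -- This choice gives q₀ = x² - 1, m₁ = x, q₁ = m₀ = 0, so the cubic is x³ - x, with three distinct
  -- roots.
  let N : Fin 5 → Fin 2 → ℂ := ![0, ![1, 0], ![-1, 0], ![0, 1], 0]
  have h := eval_scrollGenericPoly b (LinearMap.toMatrix' (b.constr ℂ N))
  simp only [LinearMap.toMatrix'_mulVec, Module.Basis.constr_basis, h0, map_zero] at h
  simp [N, pencilCubic, Cubic.discr] at h

theorem hasDimAndDegree_scroll (b : Module.Basis (Fin 5) ℂ (Fin 5 → ℂ))
    (X : Set (ℙ ℂ (Fin (4 + 1) → ℂ)))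
    (hX : ∀ p, p ∈ X ↔ ∃ α β s t, p.rep = scrollPoint b α β s t) : HasDimAndDegree X 2 3 := by
  refine ⟨scrollGenericPoly b, scrollGenericPoly_ne_zero b, fun A _ hA => ?_⟩
  rw [eval_scrollGenericPoly] at hA
  set N : Fin 2 → Fin 5 → ℂ := fun i j => A.mulVec (b j) i with hN
  have ha := left_ne_zero_of_mul hA
  have hd := right_ne_zero_of_mul hA
  have hmul (α β s t : ℂ) (i) : A.mulVec (scrollPoint b α β s t) i =
      s * (N i 1 * α ^ 2 + N i 0 * α * β + N i 2 * β ^ 2) + t * (N i 3 * α + N i 4 * β) := by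
    rw [scrollPoint.mulVec_apply]
    ring
  -- the affine parameter of the ruling through a point of the scroll
  let ratio : ℙ ℂ (Fin (4 + 1) → ℂ) → ℂ := fun p =>
    if b.repr p.rep 2 = 0 then b.repr p.rep 3 / b.repr p.rep 4
    else b.repr p.rep 0 / b.repr p.rep 2
  have hratio (c x s t : ℂ) (p : ℙ ℂ (Fin (4 + 1) → ℂ))
      (hp : p.rep = c • scrollPoint b x 1 s t) : ratio p = x := by
    have h0 := p.rep_nonzero
    rw [hp, scrollPoint.smul_eq] at h0
    simp only [ratio, hp, scrollPoint.smul_eq, scrollPoint.repr_apply]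
    by_cases hs : c * s = 0
    · have ht : c * t ≠ 0 := by
        intro ht
        simp [hs, ht, scrollPoint] at h0
      simp only [hs, Matrix.cons_val]
      simpa using mul_div_cancel_left₀ x ht
    · simp only [Matrix.cons_val]
      simp [hs]
  have hform (p) (hp : p ∈ X ∧ A.mulVec p.rep = 0) :
      ∃ x s t, p.rep = scrollPoint b x 1 s t ∧ (s ≠ 0 ∨ t ≠ 0) ∧
        ∀ i, s * (N i 1 * x ^ 2 + N i 0 * x + N i 2) + t * (N i 3 * x + N i 4) = 0 := by
    obtain ⟨hpX, hpA⟩ := hp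
    obtain ⟨α, β, s, t, h⟩ := (hX p).mp hpX
    have h0 := p.rep_nonzero
    have hi (i) := (hmul α β s t i).symm.trans (congrFun (h ▸ hpA) i)
    simp only [Pi.zero_apply] at hi
    -- On the ruling β = 0 the two equations form a linear system in sα², tα with determinant the
    -- leading coefficient of the cubic, so only the zero vector would remain.
    have hβ : β ≠ 0 := by
      rintro rfl
      have h1 : s * α ^ 2 * (pencilCubic N).a = 0 := by
        simp only [pencilCubic]
        linear_combination N 1 3 * hi 0 - N 0 3 * hi 1
      have h2 : t * α * (pencilCubic N).a = 0 := by
        simp only [pencilCubic]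
        linear_combination N 0 1 * hi 1 - N 1 1 * hi 0
      have h1' := (mul_eq_zero.mp h1).resolve_right ha
      have h2' := (mul_eq_zero.mp h2).resolve_right ha
      rw [h] at h0
      simp [scrollPoint, h1', h2'] at h0
    have hp : p.rep = scrollPoint b (α / β) 1 (s * β ^ 2) (t * β) := by
      rw [h]
      simp only [scrollPoint]
      congr! 2 <;> field_simp
    refine ⟨α / β, s * β ^ 2, t * β, hp, ?_, fun i => ?_⟩
    · by_contra! hst
      rw [hp, hst.1, hst.2] at h0
      simp [scrollPoint] at h0
    · rw [← hi i]
      field_simp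
  have hroot (x) : x ∈ (Cubic.map (RingHom.id ℂ) (pencilCubic N)).roots.toFinset ↔
      (N 0 1 * x ^ 2 + N 0 0 * x + N 0 2) * (N 1 3 * x + N 1 4) -
      (N 1 1 * x ^ 2 + N 1 0 * x + N 1 2) * (N 0 3 * x + N 0 4) = 0 := by
    rw [Multiset.mem_toFinset, Cubic.mem_roots_iff, ← pencilCubic_eval]
    · rfl
    · exact Cubic.ne_zero_of_a_ne_zero ha
  have himage : ratio '' {p | p ∈ X ∧ A.mulVec p.rep = 0} =
      ↑(Cubic.map (RingHom.id ℂ) (pencilCubic N)).roots.toFinset := by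
    ext x
    rw [Finset.mem_coe, hroot]
    constructor
    · rintro ⟨p, hp, rfl⟩
      obtain ⟨x, s, t, h, hst, hi⟩ := hform p hp
      rw [hratio 1 x s t p (by rw [h, one_smul])]
      rcases hst with hs | ht
      · refine (mul_eq_zero.mp ?_).resolve_left hs
        linear_combination (N 1 3 * x + N 1 4) * hi 0 - (N 0 3 * x + N 0 4) * hi 1
      · refine (mul_eq_zero.mp ?_).resolve_left ht
        linear_combination (N 0 1 * x ^ 2 + N 0 0 * x + N 0 2) * hi 1 -
          (N 1 1 * x ^ 2 + N 1 0 * x + N 1 2) * hi 0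
    · intro hx
      -- At a root, the matrix with rows (qᵢ, mᵢ) is singular; a kernel vector is (mᵢ, -qᵢ) for a
      -- nonzero row, or anything if both rows vanish.
      obtain ⟨s, t, hst, hi⟩ : ∃ s t : ℂ, (s ≠ 0 ∨ t ≠ 0) ∧
          ∀ i, s * (N i 1 * x ^ 2 + N i 0 * x + N i 2) + t * (N i 3 * x + N i 4) = 0 := by
        by_cases h0 : N 0 1 * x ^ 2 + N 0 0 * x + N 0 2 = 0 ∧ N 0 3 * x + N 0 4 = 0
        · by_cases h1 : N 1 1 * x ^ 2 + N 1 0 * x + N 1 2 = 0 ∧ N 1 3 * x + N 1 4 = 0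
          · exact ⟨1, 0, by simp, fun i => by fin_cases i <;> simp [h0, h1]⟩
          · refine ⟨N 1 3 * x + N 1 4, -(N 1 1 * x ^ 2 + N 1 0 * x + N 1 2), ?_, ?_⟩
            · rw [neg_ne_zero]
              tauto
            · rw [Fin.forall_fin_two]
              constructor
              · rw [h0.1, h0.2]
                ring
              · ring
        · refine ⟨N 0 3 * x + N 0 4, -(N 0 1 * x ^ 2 + N 0 0 * x + N 0 2), ?_, ?_⟩
          · rw [neg_ne_zero]
            tauto
          · rw [Fin.forall_fin_two]
            constructor
            · ring
            · linear_combination -hx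
      have hne : scrollPoint b x 1 s t ≠ 0 := by
        intro h
        have h2 := scrollPoint.repr_apply b x 1 s t 2
        have h4 := scrollPoint.repr_apply b x 1 s t 4
        rw [h] at h2 h4
        simp only [map_zero, Finsupp.coe_zero, Pi.zero_apply, Matrix.cons_val] at h2 h4
        rcases hst with hs | ht
        · exact hs (by simpa using h2.symm)
        · exact ht (by simpa using h4.symm)
      obtain ⟨c, hc⟩ := Projectivization.exists_smul_eq_mk_rep ℂ _ hne
      refine ⟨Projectivization.mk ℂ _ hne, ⟨(hX _).mpr ⟨x, 1, c * s, c * t, ?_⟩, ?_⟩,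
        hratio c x s t _ hc.symm⟩
      · rw [← hc, ← scrollPoint.smul_eq]
        rfl
      · rw [← hc]
        funext i
        change A.mulVec ((c : ℂ) • _) i = 0
        rw [Matrix.mulVec_smul, Pi.smul_apply, hmul]
        simp only [mul_one, one_pow, hi, smul_zero]
  have hinj : Set.InjOn ratio {p | p ∈ X ∧ A.mulVec p.rep = 0} := by
    intro p hp p' hp' hpp
    obtain ⟨x, s, t, h, hst, hi⟩ := hform p hp
    obtain ⟨x', s', t', h', hst', hi'⟩ := hform p' hp'
    rw [hratio 1 x s t p (by rw [h, one_smul]), hratio 1 x' s' t' p' (by rw [h', one_smul])] at hpp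
    subst hpp
    -- Two different points on one ruling would make all qᵢ and mᵢ vanish there, contradicting the
    -- nonzero discriminant.
    have hdet : s * t' = t * s' := by
      by_contra hne
      refine hd (pencilCubic_discr_eq_zero N x (fun i => ?_) fun i => ?_)
      · refine (mul_eq_zero.mp ?_).resolve_left (sub_ne_zero.mpr hne)
        linear_combination t' * hi i - t * hi' i
      · refine (mul_eq_zero.mp ?_).resolve_left (sub_ne_zero.mpr hne)
        linear_combination s * hi' i - s' * hi i
    rw [← p.mk_rep, ← p'.mk_rep, Projectivization.mk_eq_mk_iff']
    rw [h, h']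
    by_cases hs : s' = 0
    · subst hs
      have ht' : t' ≠ 0 := by tauto
      have hs : s = 0 := by simpa [ht'] using hdet
      exact ⟨t / t', by rw [scrollPoint.smul_eq, hs, mul_zero, div_mul_cancel₀ _ ht']⟩
    · refine ⟨s / s', ?_⟩
      rw [scrollPoint.smul_eq, div_mul_cancel₀ _ hs, div_mul_eq_mul_div, hdet, mul_div_cancel_right₀ _ hs]
  rw [← hinj.encard_image, himage, Set.encard_coe_eq_coe_finsetCard,
    Cubic.card_roots_of_discr_ne_zero ha (IsAlgClosed.splits _) hd]

/-! ### Ellipse conoids: regularity -/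

/-- The surface generated by the straight lines which join corresponding points of an ellipse (run
through twice) and of the line at infinity of a plane. -/
def ellipseConoid (S P R L M : ℍ[ℝ]) : Set ℍ[ℝ] :=
  {x | ∃ t u : ℝ, x = (S + Real.cos (2 * t) • P + Real.sin (2 * t) • R) +
    u • (Real.cos t • L + Real.sin t • M)}

theorem eq_zero_of_linearIndependent_four {K V : Type*} [DivisionRing K] [AddCommGroup V]
    [Module K V] {P R L M : V} (h : LinearIndependent K ![P, R, L, M]) {p r l m : K}
    (h0 : p • P + r • R + l • L + m • M = 0) : p = 0 ∧ r = 0 ∧ l = 0 ∧ m = 0 := by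
  have := Fintype.linearIndependent_iff.mp h ![p, r, l, m] (by simpa [Fin.sum_univ_four] using h0)
  exact ⟨this 0, this 1, this 2, this 3⟩

theorem isConoidalSurface_ellipseConoid {S P R L M : ℍ[ℝ]} {D : Submodule ℝ ℍ[ℝ]}
    (h : LinearIndependent ℝ ![P, R, L, M]) (hL : L ∈ D) (hM : M ∈ D) :
    IsConoidalSurface (ellipseConoid S P R L M) D := by
  refine ⟨fun t => S + Real.cos (2 * t) • P + Real.sin (2 * t) • R,
    fun t => Real.cos t • L + Real.sin t • M, ?_, ?_, fun t u => ?_,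
    fun t => D.add_mem (D.smul_mem _ hL) (D.smul_mem _ hM), rfl⟩
  · exact (contDiff_const.add ((Real.contDiff_cos.comp (contDiff_const.mul contDiff_id)).smul
      contDiff_const)).add ((Real.contDiff_sin.comp (contDiff_const.mul contDiff_id)).smul
      contDiff_const)
  · exact (Real.contDiff_cos.smul contDiff_const).add (Real.contDiff_sin.smul contDiff_const)
  · have h2 : HasDerivAt (fun t : ℝ => 2 * t) 2 t := by
      simpa using (hasDerivAt_id t).const_mul 2
    have hs : deriv (fun t : ℝ => S + Real.cos (2 * t) • P + Real.sin (2 * t) • R) t =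
        (-Real.sin (2 * t) * 2) • P + (Real.cos (2 * t) * 2) • R :=
      (((h2.cos.smul_const P).const_add S).add (h2.sin.smul_const R)).deriv
    have hr : deriv (fun t : ℝ => Real.cos t • L + Real.sin t • M) t =
        (-Real.sin t) • L + Real.cos t • M :=
      (((Real.hasDerivAt_cos t).smul_const L).add ((Real.hasDerivAt_sin t).smul_const M)).deriv
    rw [hs, hr, LinearIndependent.pair_iff]
    intro a b hab
    have h0 : (a * (-Real.sin (2 * t) * 2)) • P + (a * (Real.cos (2 * t) * 2)) • R +
        (b * Real.cos t - a * u * Real.sin t) • L +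
        (b * Real.sin t + a * u * Real.cos t) • M = 0 := by
      rw [← hab]
      module
    obtain ⟨e1, e2, e3, e4⟩ := eq_zero_of_linearIndependent_four h h0
    have ha : a = 0 := by
      linear_combination -(Real.sin (2 * t) / 2) * e1 + (Real.cos (2 * t) / 2) * e2 -
        a * Real.sin_sq_add_cos_sq (2 * t)
    refine ⟨ha, ?_⟩
    subst ha
    linear_combination Real.cos t * e3 + Real.sin t * e4 - b * Real.sin_sq_add_cos_sq t

/-! ### The projective closure of an ellipse conoid -/

/-- The complexification of the 4-space, as the direction of the complex affine 4-space. -/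
noncomputable def toDirection : ℍ[ℝ] →ₗ[ℝ] Fin 5 → ℂ where
  toFun x := ![0, (x.re : ℂ), (x.imI : ℂ), (x.imJ : ℂ), (x.imK : ℂ)]
  map_add' x y := by
    ext i
    fin_cases i <;> simp
  map_smul' c x := by
    ext i
    fin_cases i <;> simp

theorem toDirection_apply (x : ℍ[ℝ]) :
    toDirection x = ![0, (x.re : ℂ), (x.imI : ℂ), (x.imJ : ℂ), (x.imK : ℂ)] := rfl

theorem exists_toProjFour_rep (x : ℍ[ℝ]) :
    ∃ c : ℂˣ, (toProjFour x).rep = (c : ℂ) • (Pi.single 0 1 + toDirection x) := by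
  have h : ![1, (x.re : ℂ), (x.imI : ℂ), (x.imJ : ℂ), (x.imK : ℂ)] =
      Pi.single 0 1 + toDirection x := by
    ext i
    fin_cases i <;> simp [toDirection_apply]
  obtain ⟨c, hc⟩ := Projectivization.exists_smul_eq_mk_rep ℂ _ (fun h => one_ne_zero (congrFun h 0) :
    ![1, (x.re : ℂ), (x.imI : ℂ), (x.imJ : ℂ), (x.imK : ℂ)] ≠ 0)
  exact ⟨c, by rw [← h]; exact hc.symm⟩

theorem linearIndependent_toDirection {P R L M : ℍ[ℝ]} (h : LinearIndependent ℝ ![P, R, L, M])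
    {p r l m : ℂ} (h0 : p • toDirection P + r • toDirection R + l • toDirection L +
      m • toDirection M = 0) : p = 0 ∧ r = 0 ∧ l = 0 ∧ m = 0 := by
  have c1 := congrFun h0 1
  have c2 := congrFun h0 2
  have c3 := congrFun h0 3
  have c4 := congrFun h0 4
  simp [toDirection_apply, Complex.ext_iff] at c1 c2 c3 c4
  have hre : p.re • P + r.re • R + l.re • L + m.re • M = 0 := by
    ext <;> simp
    exacts [c1.1, c2.1, c3.1, c4.1]
  have him : p.im • P + r.im • R + l.im • L + m.im • M = 0 := by
    ext <;> simp
    exacts [c1.2, c2.2, c3.2, c4.2]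
  obtain ⟨a1, a2, a3, a4⟩ := eq_zero_of_linearIndependent_four h hre
  obtain ⟨b1, b2, b3, b4⟩ := eq_zero_of_linearIndependent_four h him
  exact ⟨Complex.ext a1 b1, Complex.ext a2 b2, Complex.ext a3 b3, Complex.ext a4 b4⟩

/-- The vectors which determine the projective closure of an ellipse conoid as a scroll. -/
noncomputable def conoidVectors (S P R L M : ℍ[ℝ]) : Fin 5 → Fin 5 → ℂ :=
  ![Pi.single 0 1 + toDirection S,
    (1 / 2 : ℂ) • toDirection P - (Complex.I / 2) • toDirection R,
    (1 / 2 : ℂ) • toDirection P + (Complex.I / 2) • toDirection R,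
    (1 / 2 : ℂ) • toDirection L - (Complex.I / 2) • toDirection M,
    (1 / 2 : ℂ) • toDirection L + (Complex.I / 2) • toDirection M]

theorem linearIndependent_conoidVectors (S : ℍ[ℝ]) {P R L M : ℍ[ℝ]}
    (h : LinearIndependent ℝ ![P, R, L, M]) :
    LinearIndependent ℂ (conoidVectors S P R L M) := by
  rw [Fintype.linearIndependent_iff]
  intro g hg
  simp only [Fin.sum_univ_five, conoidVectors, Matrix.cons_val] at hg
  have h0 : g 0 = 0 := by simpa [toDirection_apply, Matrix.vecHead] using congrFun hg 0
  rw [h0] at hg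
  obtain ⟨e1, e2, e3, e4⟩ := linearIndependent_toDirection h (p := (g 1 + g 2) / 2)
    (r := (g 2 - g 1) * (Complex.I / 2)) (l := (g 3 + g 4) / 2)
    (m := (g 4 - g 3) * (Complex.I / 2)) (by rw [← hg]; module)
  have hI : Complex.I / 2 ≠ 0 := by simp
  replace e2 := (mul_eq_zero.mp e2).resolve_right hI
  replace e4 := (mul_eq_zero.mp e4).resolve_right hI
  have h1 : g 1 = 0 := by linear_combination e1 - e2 / 2
  have h2 : g 2 = 0 := by linear_combination e1 + e2 / 2
  have h3 : g 3 = 0 := by linear_combination e3 - e4 / 2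
  have h4 : g 4 = 0 := by linear_combination e3 + e4 / 2
  intro i
  fin_cases i <;> assumption

/-- The basis which determines the projective closure of an ellipse conoid as a scroll. -/
noncomputable def conoidBasis (S : ℍ[ℝ]) {P R L M : ℍ[ℝ]}
    (h : LinearIndependent ℝ ![P, R, L, M]) : Module.Basis (Fin 5) ℂ (Fin 5 → ℂ) :=
  basisOfLinearIndependentOfCardEqFinrank (linearIndependent_conoidVectors S h) (by simp)

/-- The basis is chosen so that αβ = x² + y², (α² + β²)/2 = x² - y² and (α² - β²)/(2i) = 2xy become
the coefficients of the centre, of P and of R. -/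
theorem scrollPoint_conoidBasis (S : ℍ[ℝ]) {P R L M : ℍ[ℝ]}
    (h : LinearIndependent ℝ ![P, R, L, M]) (x y s t : ℂ) :
    scrollPoint (conoidBasis S h) (x + y * Complex.I) (x - y * Complex.I) s t =
      (s * (x ^ 2 + y ^ 2)) • (Pi.single 0 1 + toDirection S) +
        (s * (x ^ 2 - y ^ 2)) • toDirection P + (s * (2 * x * y)) • toDirection R +
        (t * x) • toDirection L + (t * y) • toDirection M := by
  simp only [scrollPoint, conoidBasis, coe_basisOfLinearIndependentOfCardEqFinrank, conoidVectors,
    Matrix.cons_val]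
  match_scalars
  · linear_combination -s * y ^ 2 * Complex.I_sq
  · linear_combination -s * y ^ 2 * Complex.I_sq
  · linear_combination s * y ^ 2 * Complex.I_sq
  · linear_combination -s * 2 * x * y * Complex.I_sq
  · ring
  · linear_combination -t * y * Complex.I_sq

theorem scrollPoint_conoidBasis_cos_sin (S : ℍ[ℝ]) {P R L M : ℍ[ℝ]}
    (h : LinearIndependent ℝ ![P, R, L, M]) (s t : ℂ) (ρ θ u : ℝ) (ht : t * ρ = s * ρ ^ 2 * u) :
    scrollPoint (conoidBasis S h) ((ρ * Real.cos θ : ℝ) + (ρ * Real.sin θ : ℝ) * Complex.I)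
      ((ρ * Real.cos θ : ℝ) - (ρ * Real.sin θ : ℝ) * Complex.I) s t =
      (s * ρ ^ 2) • (Pi.single 0 1 + toDirection ((S + Real.cos (2 * θ) • P +
        Real.sin (2 * θ) • R) + u • (Real.cos θ • L + Real.sin θ • M))) := by
  have hsmul (a : ℝ) (v : Fin 5 → ℂ) : a • v = (a : ℂ) • v := rfl
  rw [scrollPoint_conoidBasis]
  simp only [map_add, map_smul, hsmul]
  have h1 : (Real.cos θ : ℂ) ^ 2 + (Real.sin θ : ℂ) ^ 2 = 1 := by
    exact_mod_cast Real.cos_sq_add_sin_sq θ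
  rw [Real.cos_two_mul', Real.sin_two_mul]
  push_cast at h1 ⊢
  match_scalars
  · linear_combination s * ρ ^ 2 * h1
  · linear_combination s * ρ ^ 2 * h1
  · ring
  · ring
  · linear_combination Complex.cos θ * ht
  · linear_combination Complex.sin θ * ht

theorem hasDimAndDegree_ellipseConoid (S : ℍ[ℝ]) {P R L M : ℍ[ℝ]}
    (h : LinearIndependent ℝ ![P, R, L, M]) :
    HasDimAndDegree (projectiveClosure (ellipseConoid S P R L M)) 2 3 := by
  refine hasDimAndDegree_scroll (conoidBasis S h) _ fun p =>
    ⟨zariskiClosure_subset_scroll _ ?_, scroll_subset_zariskiClosure _ ?_⟩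
  · rintro _ ⟨_, ⟨θ, u, rfl⟩, rfl⟩
    obtain ⟨c, hc⟩ := exists_toProjFour_rep ((S + Real.cos (2 * θ) • P +
      Real.sin (2 * θ) • R) + u • (Real.cos θ • L + Real.sin θ • M))
    refine ⟨Real.cos θ + Real.sin θ * Complex.I, Real.cos θ - Real.sin θ * Complex.I, c, c * u, ?_⟩
    rw [hc]
    simpa using (scrollPoint_conoidBasis_cos_sin S h c (c * u) 1 θ u (by simp)).symm
  · intro x y s t hxy hs
    set z : ℂ := ⟨x, y⟩ with hz
    have hz0 : ‖z‖ ≠ 0 := by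
      intro h0
      rw [norm_eq_zero, Complex.ext_iff] at h0
      simp only [hz, Complex.zero_re, Complex.zero_im] at h0
      simp [h0] at hxy
    have hx : x = ‖z‖ * Real.cos z.arg := (Complex.norm_mul_cos_arg z).symm
    have hy : y = ‖z‖ * Real.sin z.arg := (Complex.norm_mul_sin_arg z).symm
    -- The ruling parameter u solves tρ = sρ²u with ρ = ‖z‖.
    refine ⟨_, ⟨_, ⟨z.arg, t / (s * ‖z‖), rfl⟩, rfl⟩, ?_⟩
    obtain ⟨c, hc⟩ := exists_toProjFour_rep ((S + Real.cos (2 * z.arg) • P +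
      Real.sin (2 * z.arg) • R) + (t / (s * ‖z‖)) • (Real.cos z.arg • L + Real.sin z.arg • M))
    refine ⟨s * ‖z‖ ^ 2 * (c : ℂ)⁻¹, ?_⟩
    rw [hc, smul_smul, inv_mul_cancel_right₀ c.ne_zero]
    have := scrollPoint_conoidBasis_cos_sin S h s t ‖z‖ z.arg (t / (s * ‖z‖)) (by
      push_cast
      have : (s : ℂ) ≠ 0 := by exact_mod_cast hs
      have : (‖z‖ : ℂ) ≠ 0 := by exact_mod_cast hz0
      field_simp)
    rwa [← hx, ← hy] at this

/-! ### Lines and their homogeneous minimal coordinates -/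

theorem mem_pureQuaternions {l : ℍ[ℝ]} : l ∈ pureQuaternions ↔ l.re = 0 := Iff.rfl

theorem inner_eq_re_star_mul (x y : ℍ[ℝ]) : inner ℝ x y = (star x * y).re := by
  rw [Quaternion.inner_def]
  simp only [Quaternion.re_mul, Quaternion.re_star, Quaternion.imI_star, Quaternion.imJ_star,
    Quaternion.imK_star]
  ring

/-- The straight line with given homogeneous minimal coordinates. -/
noncomputable def lineOfCoords (l m : ℍ[ℝ]) : AffineSubspace ℝ ℍ[ℝ] :=
  AffineSubspace.mk' ((Quaternion.normSq l)⁻¹ • (l * m)) (ℝ ∙ l)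

theorem mem_lineOfCoords {l m x : ℍ[ℝ]} :
    x ∈ lineOfCoords l m ↔ ∃ u : ℝ, x = (Quaternion.normSq l)⁻¹ • (l * m) + u • l := by
  rw [lineOfCoords, AffineSubspace.mem_mk', Submodule.mem_span_singleton, vsub_eq_sub]
  exact exists_congr fun u => by rw [eq_sub_iff_add_eq, eq_comm, add_comm]

theorem lineOfCoords_smul (l m : ℍ[ℝ]) {c : ℝ} (hc : c ≠ 0) :
    lineOfCoords (c • l) (c • m) = lineOfCoords l m := by
  rw [lineOfCoords, lineOfCoords, Submodule.span_singleton_smul_eq (IsUnit.mk0 c hc)]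
  congr 1
  rw [Quaternion.normSq_smul, smul_mul_smul_comm, smul_smul, mul_inv]
  congr 1
  field_simp

namespace OrthLine

theorem direction_eq_span_of_mem (ℓ : OrthLine) {l : ℍ[ℝ]} (hl : l ∈ ℓ.line.direction)
    (h0 : l ≠ 0) : ℓ.line.direction = ℝ ∙ l := by
  refine (Submodule.eq_of_le_of_finrank_eq ?_ ?_).symm
  · rwa [Submodule.span_singleton_le_iff_mem]
  · rw [finrank_span_singleton h0, ℓ.finrank_direction]

theorem pedalPoint_mem (ℓ : OrthLine) : ℓ.pedalPoint ∈ ℓ.line :=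
  EuclideanGeometry.orthogonalProjection_mem _

theorem line_eq_lineOfCoords (ℓ : OrthLine) :
    ℓ.line = lineOfCoords ℓ.dir (star ℓ.dir * ℓ.pedalPoint) := by
  have h0 : Quaternion.normSq ℓ.dir ≠ 0 := Quaternion.normSq_ne_zero.mpr ℓ.dir_ne_zero
  rw [lineOfCoords, ← mul_assoc, Quaternion.self_mul_star, Quaternion.coe_mul_eq_smul, smul_smul,
    inv_mul_cancel₀ h0, one_smul, ← ℓ.direction_eq_span_of_mem ℓ.dir_mem ℓ.dir_ne_zero,
    AffineSubspace.mk'_eq ℓ.pedalPoint_mem]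

/-- The base point is orthogonal to l because re(l̃ l m) = |l|² re m = 0; this is where purity of m
enters. -/
theorem pedalPoint_eq_of_line_eq (ℓ : OrthLine) {l m : ℍ[ℝ]} (hm : m ∈ pureQuaternions)
    (h : ℓ.line = lineOfCoords l m) :
    ℓ.pedalPoint = (Quaternion.normSq l)⁻¹ • (l * m) := by
  refine EuclideanGeometry.coe_orthogonalProjection_eq_iff_mem.mpr ⟨?_, ?_⟩
  · rw [h]
    exact AffineSubspace.self_mem_mk' _ _
  · rw [h, lineOfCoords, AffineSubspace.direction_mk', Submodule.mem_orthogonal_singleton_iff_inner_right,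
      vsub_eq_sub, zero_sub, inner_neg_right, inner_smul_right, inner_eq_re_star_mul, ← mul_assoc,
      Quaternion.star_mul_self, Quaternion.coe_mul_eq_smul, Quaternion.re_smul, mem_pureQuaternions.mp hm]
    simp

theorem toProjFive_eq_mk_iff (ℓ : OrthLine) {v : pureQuaternions × pureQuaternions} (hv : v ≠ 0)
    (h0 : v.1 ≠ 0) :
    ℓ.toProjFive = Projectivization.mk ℝ v hv ↔ ℓ.line = lineOfCoords v.1 v.2 := by
  obtain ⟨⟨l, hl⟩, m, hm⟩ := v
  replace h0 : l ≠ 0 := fun h => h0 (Subtype.ext h)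
  simp only
  rw [toProjFive, Projectivization.mk_eq_mk_iff']
  constructor
  · rintro ⟨c, hc⟩
    have h1 : c • l = ℓ.dir := congrArg (fun v => (v.1 : ℍ[ℝ])) hc
    have h2 : c • m = star ℓ.dir * ℓ.pedalPoint := congrArg (fun v => (v.2 : ℍ[ℝ])) hc
    have hc0 : c ≠ 0 := by
      rintro rfl
      exact ℓ.dir_ne_zero (by rw [← h1, zero_smul])
    rw [ℓ.line_eq_lineOfCoords, ← h2, ← h1, lineOfCoords_smul _ _ hc0]
  · intro h
    have hd : ℓ.dir ∈ ℝ ∙ l := by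
      have := ℓ.dir_mem
      rwa [h, lineOfCoords, AffineSubspace.direction_mk'] at this
    obtain ⟨c, hc⟩ := Submodule.mem_span_singleton.mp hd
    refine ⟨c, Prod.ext (Subtype.ext hc) (Subtype.ext ?_)⟩
    change c • m = star ℓ.dir * ℓ.pedalPoint
    have hn : Quaternion.normSq l ≠ 0 := Quaternion.normSq_ne_zero.mpr h0
    rw [ℓ.pedalPoint_eq_of_line_eq hm h, ← hc, Quaternion.star_smul, mul_smul_comm,
      smul_mul_assoc, ← mul_assoc, Quaternion.star_mul_self, Quaternion.coe_mul_eq_smul, smul_smul,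
      smul_smul]
    congr 1
    field_simp

theorem existsUnique_toProjFive_eq {v : pureQuaternions × pureQuaternions} (hv : v ≠ 0)
    (h0 : v.1 ≠ 0) : ∃! ℓ : OrthLine, ℓ.toProjFive = Projectivization.mk ℝ v hv := by
  simp only [toProjFive_eq_mk_iff _ hv h0]
  have h0' : (v.1 : ℍ[ℝ]) ≠ 0 := fun h => h0 (Subtype.ext h)
  refine ⟨⟨lineOfCoords v.1 v.2, ?_, ?_⟩, rfl, fun ℓ hℓ => ?_⟩
  · rw [lineOfCoords, AffineSubspace.direction_mk', finrank_span_singleton h0']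
  · rw [lineOfCoords, AffineSubspace.direction_mk', Submodule.span_singleton_le_iff_mem]
    exact v.1.2
  · cases ℓ
    simp only at hℓ
    subst hℓ
    rfl

/-- A representative of the point of a line in the projective 5-space. -/
noncomputable def coords (ℓ : OrthLine) : pureQuaternions × pureQuaternions :=
  (⟨ℓ.dir, ℓ.direction_le ℓ.dir_mem⟩, ⟨star ℓ.dir * ℓ.pedalPoint, ℓ.star_dir_mul_pedalPoint_mem⟩)

theorem coords_ne_zero (ℓ : OrthLine) : ℓ.coords ≠ 0 :=
  fun h => ℓ.dir_ne_zero (congrArg Subtype.val (congrArg Prod.fst h))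

theorem toProjFive_eq_mk (ℓ : OrthLine) :
    ℓ.toProjFive = Projectivization.mk ℝ ℓ.coords ℓ.coords_ne_zero := rfl

end OrthLine

/-! ### The join line, skewness and an orthonormal basis -/

theorem Projectivization.Subspace.span_pair_mk {K V : Type*} [DivisionRing K] [AddCommGroup V]
    [Module K V] {v w : V} (hv : v ≠ 0) (hw : w ≠ 0) :
    Projectivization.Subspace.span {Projectivization.mk K v hv, Projectivization.mk K w hw} =
      (Submodule.span K {v, w}).projectivization := by
  refine Projectivization.Subspace.span_eq_of_le ?_ ?_
  · rintro p (rfl | rfl) <;> rw [SetLike.mem_coe, Submodule.mk_mem_projectivization_iff] <;>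
      exact Submodule.subset_span (by simp)
  · rw [← Projectivization.Subspace.submodule.le_iff_le, OrderIso.apply_symm_apply,
      Submodule.span_le]
    rintro x (rfl | rfl)
    · rw [SetLike.mem_coe, Projectivization.Subspace.mem_submodule_iff _ hv]
      exact Projectivization.Subspace.subset_span _ (by simp)
    · rw [SetLike.mem_coe, Projectivization.Subspace.mem_submodule_iff _ hw]
      exact Projectivization.Subspace.subset_span _ (by simp)

theorem joinLine_eq (ℓ₁ ℓ₂ : OrthLine) :
    joinLine ℓ₁ ℓ₂ = (Submodule.span ℝ {ℓ₁.coords, ℓ₂.coords}).projectivization :=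
  Projectivization.Subspace.span_pair_mk _ _

theorem finrank_span_pair_le {K V : Type*} [DivisionRing K] [AddCommGroup V] [Module K V]
    (v w : V) : Module.finrank K (Submodule.span K {v, w}) ≤ 2 := by
  classical
  have := finrank_span_finset_le_card (R := K) ({v, w} : Finset V)
  rw [Finset.coe_pair] at this
  exact this.trans Finset.card_le_two

theorem OrthLine.Skew.dir_ne_smul {ℓ₁ ℓ₂ : OrthLine} (h : ℓ₁.Skew ℓ₂) (c : ℝ) :
    ℓ₂.dir ≠ c • ℓ₁.dir := by
  intro hc
  have hle : (ℓ₁.line ⊔ ℓ₂.line).direction ≤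
      Submodule.span ℝ {ℓ₁.dir, ℓ₂.pedalPoint -ᵥ ℓ₁.pedalPoint} := by
    rw [AffineSubspace.direction_sup ℓ₁.pedalPoint_mem ℓ₂.pedalPoint_mem,
      ℓ₁.direction_eq_span_of_mem ℓ₁.dir_mem ℓ₁.dir_ne_zero,
      ℓ₂.direction_eq_span_of_mem ℓ₂.dir_mem ℓ₂.dir_ne_zero]
    simp only [sup_le_iff, Submodule.span_singleton_le_iff_mem]
    refine ⟨⟨Submodule.subset_span (by simp), ?_⟩, Submodule.subset_span (by simp)⟩
    rw [hc]
    exact Submodule.smul_mem _ _ (Submodule.subset_span (by simp))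
  have h3 := (Submodule.finrank_mono hle).trans (finrank_span_pair_le _ _)
  rw [h] at h3
  norm_num at h3

theorem OrthLine.Skew.not_le_mk' {ℓ₁ ℓ₂ : OrthLine} (h : ℓ₁.Skew ℓ₂) (S L M : ℍ[ℝ])
    (h1 : ∀ x ∈ ℓ₁.line, x - S ∈ Submodule.span ℝ {L, M})
    (h2 : ∀ x ∈ ℓ₂.line, x - S ∈ Submodule.span ℝ {L, M}) : False := by
  have hle : ℓ₁.line ⊔ ℓ₂.line ≤ AffineSubspace.mk' S (Submodule.span ℝ {L, M}) :=
    sup_le (fun x hx => AffineSubspace.mem_mk'.mpr (h1 x hx))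
      fun x hx => AffineSubspace.mem_mk'.mpr (h2 x hx)
  have hd := AffineSubspace.direction_le hle
  rw [AffineSubspace.direction_mk'] at hd
  have h3 := (Submodule.finrank_mono hd).trans (finrank_span_pair_le _ _)
  rw [h] at h3
  norm_num at h3

/-- Gram–Schmidt on the first components, with the second components carried along. -/
theorem exists_orthonormal_fst {E F : Type*} [NormedAddCommGroup E] [InnerProductSpace ℝ E]
    [AddCommGroup F] [Module ℝ F] {v₁ v₂ : E × F} (h1 : v₁.1 ≠ 0)
    (h2 : ∀ c : ℝ, v₂.1 ≠ c • v₁.1) : ∃ w₁ w₂ : E × F,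
      Submodule.span ℝ {v₁, v₂} = Submodule.span ℝ {w₁, w₂} ∧ ‖w₁.1‖ = 1 ∧ ‖w₂.1‖ = 1 ∧
        inner ℝ w₁.1 w₂.1 = 0 := by
  have hn : ‖v₁.1‖ ≠ 0 := norm_ne_zero_iff.mpr h1
  set c : ℝ := inner ℝ v₁.1 v₂.1 / ‖v₁.1‖ ^ 2 with hc
  have hk : v₂.1 - c • v₁.1 ≠ 0 := sub_ne_zero.mpr (h2 c)
  have hk' : ‖v₂.1 - c • v₁.1‖ ≠ 0 := norm_ne_zero_iff.mpr hk
  refine ⟨‖v₁.1‖⁻¹ • v₁, ‖v₂.1 - c • v₁.1‖⁻¹ • (v₂ - c • v₁), le_antisymm ?_ ?_, ?_, ?_, ?_⟩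
  · simp only [Submodule.span_le, Set.pair_subset_iff, SetLike.mem_coe, Submodule.mem_span_pair]
    constructor
    · exact ⟨‖v₁.1‖, 0, by rw [smul_smul, mul_inv_cancel₀ hn]; simp⟩
    · refine ⟨c * ‖v₁.1‖, ‖v₂.1 - c • v₁.1‖, ?_⟩
      rw [smul_smul, smul_smul, mul_inv_cancel₀ hk', mul_inv_cancel_right₀ hn]
      module
  · rw [Submodule.span_le]
    rintro _ (rfl | rfl) <;> rw [SetLike.mem_coe, Submodule.mem_span_pair]
    · exact ⟨‖v₁.1‖⁻¹, 0, by rw [zero_smul, add_zero]⟩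
    · exact ⟨-(‖v₂.1 - c • v₁.1‖⁻¹ * c), ‖v₂.1 - c • v₁.1‖⁻¹, by module⟩
  · rw [Prod.smul_fst, norm_smul, norm_inv, norm_norm, inv_mul_cancel₀ hn]
  · rw [Prod.smul_fst, Prod.fst_sub, Prod.smul_fst, norm_smul, norm_inv, norm_norm,
      inv_mul_cancel₀ hk']
  · rw [Prod.smul_fst, Prod.smul_fst, Prod.fst_sub, Prod.smul_fst, inner_smul_left,
      inner_smul_right, inner_sub_right, inner_smul_right, real_inner_self_eq_norm_sq, hc,
      div_mul_cancel₀ _ (pow_ne_zero 2 hn), sub_self, mul_zero, mul_zero]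

theorem mem_correspondingSet_iff {W : Submodule ℝ (pureQuaternions × pureQuaternions)}
    (hW : ∀ v ∈ W, v ≠ 0 → v.1 ≠ 0) {x : ℍ[ℝ]} :
    x ∈ correspondingSet W.projectivization ↔ ∃ v ∈ W, v ≠ 0 ∧ x ∈ lineOfCoords v.1 v.2 := by
  constructor
  · rintro ⟨ℓ, hℓ, hx⟩
    refine ⟨ℓ.coords, ?_, ℓ.coords_ne_zero, ?_⟩
    · rwa [ℓ.toProjFive_eq_mk, Submodule.mk_mem_projectivization_iff] at hℓ
    · rwa [ℓ.line_eq_lineOfCoords] at hx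
  · rintro ⟨v, hv, hv0, hx⟩
    obtain ⟨ℓ, hℓ, -⟩ := OrthLine.existsUnique_toProjFive_eq hv0 (hW v hv hv0)
    refine ⟨ℓ, ?_, ?_⟩
    · rwa [hℓ, Submodule.mk_mem_projectivization_iff]
    · rwa [(ℓ.toProjFive_eq_mk_iff hv0 (hW v hv hv0)).mp hℓ]

/-! ### Quaternion algebra of an orthonormal pair -/

theorem mul_self_of_mem_pureQuaternions {L : ℍ[ℝ]} (hL : L ∈ pureQuaternions) (hL1 : ‖L‖ = 1) :
    L * L = -1 := by
  have h := Quaternion.self_mul_star L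
  rwa [Quaternion.star_eq_neg.mpr hL, Quaternion.normSq_eq_norm_mul_self, hL1, mul_one,
    Quaternion.coe_one, mul_neg, neg_eq_iff_eq_neg] at h

theorem mul_eq_neg_mul_of_inner_eq_zero {L M : ℍ[ℝ]} (hL : L ∈ pureQuaternions)
    (hM : M ∈ pureQuaternions) (hLM : inner ℝ L M = 0) : M * L = -(L * M) := by
  have hL' : L.re = 0 := hL
  have hM' : M.re = 0 := hM
  rw [Quaternion.inner_def] at hLM
  simp [hL', hM'] at hLM
  ext <;> simp [hL', hM']
  · linarith
  all_goals ring

theorem normSq_smul_add_smul {L M : ℍ[ℝ]} (hL1 : ‖L‖ = 1) (hM1 : ‖M‖ = 1)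
    (hLM : inner ℝ L M = 0) (a b : ℝ) :
    Quaternion.normSq (a • L + b • M) = a ^ 2 + b ^ 2 := by
  rw [Quaternion.normSq_eq_norm_mul_self, ← real_inner_self_eq_norm_mul_norm]
  have h1 : inner ℝ L L = 1 := by rw [real_inner_self_eq_norm_sq, hL1, one_pow]
  have h2 : inner ℝ M M = 1 := by rw [real_inner_self_eq_norm_sq, hM1, one_pow]
  simp only [inner_add_left, inner_add_right, real_inner_smul_left, real_inner_smul_right,
    h1, h2, hLM, real_inner_comm L M]
  ring

/-- For (a, b) = (cos t, sin t) the coefficients are 1, cos 2t, sin 2t: this is why the pedal curve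
is an ellipse run through twice. -/
theorem smul_add_smul_mul (L M A B : ℍ[ℝ]) (a b : ℝ) :
    (a • L + b • M) * (a • A + b • B) = (a ^ 2 + b ^ 2) • ((1 / 2 : ℝ) • (L * A + M * B)) +
      (a ^ 2 - b ^ 2) • ((1 / 2 : ℝ) • (L * A - M * B)) +
      (2 * a * b) • ((1 / 2 : ℝ) • (L * B + M * A)) := by
  simp only [add_mul, mul_add, smul_mul_smul_comm]
  module

/-- Left multiplication by `L * M` acts as a rotation through a right angle in the plane of `L` and
`M` and in the plane of the two other vectors. -/
theorem mul_mul_eq_of_anticommute {L M : ℍ[ℝ]} (hL : L * L = -1) (hM : M * M = -1)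
    (hLM : M * L = -(L * M)) (A B : ℍ[ℝ]) :
    L * M * L = M ∧ L * M * M = -L ∧
      L * M * ((1 / 2 : ℝ) • (L * A - M * B)) = (1 / 2 : ℝ) • (L * B + M * A) ∧
      L * M * ((1 / 2 : ℝ) • (L * B + M * A)) = -((1 / 2 : ℝ) • (L * A - M * B)) := by
  have h1 : L * M * L = M := by
    rw [mul_assoc, hLM, mul_neg, ← mul_assoc, hL, neg_mul, one_mul, neg_neg]
  have h2 : L * M * M = -L := by rw [mul_assoc, hM, mul_neg, mul_one]
  refine ⟨h1, h2, ?_, ?_⟩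
  · rw [mul_smul_comm, mul_sub, ← mul_assoc, ← mul_assoc, h1, h2, neg_mul]
    module
  · rw [mul_smul_comm, mul_add, ← mul_assoc, ← mul_assoc, h1, h2, neg_mul]
    module

theorem linearIndependent_of_notMem_span {L M A B : ℍ[ℝ]} (hL : L * L = -1) (hM : M * M = -1)
    (hLM : M * L = -(L * M))
    (hP : (1 / 2 : ℝ) • (L * A - M * B) ∉ Submodule.span ℝ {L, M}) :
    LinearIndependent ℝ
      ![(1 / 2 : ℝ) • (L * A - M * B), (1 / 2 : ℝ) • (L * B + M * A), L, M] := by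
  obtain ⟨hnL, hnM, hnP, hnR⟩ := mul_mul_eq_of_anticommute hL hM hLM A B
  generalize (1 / 2 : ℝ) • (L * A - M * B) = P at *
  generalize (1 / 2 : ℝ) • (L * B + M * A) = R at *
  rw [Fintype.linearIndependent_iff]
  intro g hg
  simp only [Fin.sum_univ_four, Matrix.cons_val] at hg
  have hn : g 0 • R - g 1 • P + g 2 • M - g 3 • L = 0 := by
    have := congrArg (L * M * ·) hg
    simp only [mul_add, mul_smul_comm, hnL, hnM, hnP, hnR, mul_zero] at this
    rw [← this]
    module
  -- Eliminating R between the relation and its image under LM amounts to dividing by the complex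
  -- number g₀ + i g₁.
  have hsum : (g 0 ^ 2 + g 1 ^ 2) • P =
      (-(g 0 * g 2 + g 1 * g 3)) • L + (g 1 * g 2 - g 0 * g 3) • M := by
    linear_combination (norm := module) g 0 • hg - g 1 • hn
  have h01 : g 0 ^ 2 + g 1 ^ 2 = 0 := by
    by_contra h0
    refine hP (((Submodule.span ℝ {L, M}).smul_mem_iff h0).mp ?_)
    rw [hsum]
    exact Submodule.mem_span_pair.mpr ⟨_, _, rfl⟩
  have h0 : g 0 = 0 := by nlinarith [sq_nonneg (g 0), sq_nonneg (g 1)]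
  have h1 : g 1 = 0 := by nlinarith [sq_nonneg (g 0), sq_nonneg (g 1)]
  rw [h0, h1, zero_smul, zero_smul, zero_add, zero_add] at hg
  -- The square of g₂L + g₃M is -(g₂² + g₃²), since L and M anticommute.
  have hsq : (g 2 ^ 2 + g 3 ^ 2) • (1 : ℍ[ℝ]) = 0 := by
    have := congrArg (fun x => x * x) hg
    simp only [add_mul, mul_add, smul_mul_smul_comm, hL, hM, hLM, mul_zero] at this
    rw [← neg_eq_zero, ← this]
    module
  have h23 : g 2 ^ 2 + g 3 ^ 2 = 0 := (smul_eq_zero.mp hsq).resolve_right one_ne_zero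
  have h2 : g 2 = 0 := by nlinarith [sq_nonneg (g 2), sq_nonneg (g 3)]
  have h3 : g 3 = 0 := by nlinarith [sq_nonneg (g 2), sq_nonneg (g 3)]
  intro i
  fin_cases i <;> assumption

theorem smul_add_mem_span_of_smul_sub_mem_span {L M A B : ℍ[ℝ]} (hL : L * L = -1) (hM : M * M = -1)
    (hLM : M * L = -(L * M))
    (hP : (1 / 2 : ℝ) • (L * A - M * B) ∈ Submodule.span ℝ {L, M}) :
    (1 / 2 : ℝ) • (L * B + M * A) ∈ Submodule.span ℝ {L, M} := by
  obtain ⟨hnL, hnM, hnP, -⟩ := mul_mul_eq_of_anticommute hL hM hLM A B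
  obtain ⟨a, b, hab⟩ := Submodule.mem_span_pair.mp hP
  rw [← hnP, ← hab]
  refine Submodule.mem_span_pair.mpr ⟨-b, a, ?_⟩
  rw [mul_add, mul_smul_comm, mul_smul_comm, hnL, hnM]
  module

/-! ### The surface of a join line -/

theorem correspondingSet_eq_ellipseConoid {w₁ w₂ : pureQuaternions × pureQuaternions}
    (h1 : ‖w₁.1‖ = 1) (h2 : ‖w₂.1‖ = 1) (h12 : inner ℝ w₁.1 w₂.1 = 0)
    (hW : ∀ v ∈ Submodule.span ℝ {w₁, w₂}, v ≠ 0 → v.1 ≠ 0) :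
    correspondingSet (Submodule.span ℝ {w₁, w₂}).projectivization =
      ellipseConoid ((1 / 2 : ℝ) • (w₁.1 * w₁.2 + w₂.1 * w₂.2 : ℍ[ℝ]))
        ((1 / 2 : ℝ) • (w₁.1 * w₁.2 - w₂.1 * w₂.2 : ℍ[ℝ]))
        ((1 / 2 : ℝ) • (w₁.1 * w₂.2 + w₂.1 * w₁.2 : ℍ[ℝ])) w₁.1 w₂.1 := by
  have hn (a b : ℝ) := normSq_smul_add_smul (L := w₁.1) (M := w₂.1) h1 h2 h12 a b
  ext x
  rw [mem_correspondingSet_iff hW]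
  constructor
  · rintro ⟨v, hv, hv0, hx⟩
    obtain ⟨a, b, rfl⟩ := Submodule.mem_span_pair.mp hv
    obtain ⟨u, rfl⟩ := mem_lineOfCoords.mp hx
    -- Polar coordinates for (a, b): the modulus cancels in the pedal point and is absorbed into u
    -- along the ruling.
    set z : ℂ := ⟨a, b⟩ with hz
    have hz0 : ‖z‖ ≠ 0 := by
      intro h0
      rw [norm_eq_zero, Complex.ext_iff] at h0
      simp only [hz, Complex.zero_re, Complex.zero_im] at h0
      simp [h0] at hv0
    have ha : a = ‖z‖ * Real.cos z.arg := (Complex.norm_mul_cos_arg z).symm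
    have hb : b = ‖z‖ * Real.sin z.arg := (Complex.norm_mul_sin_arg z).symm
    refine ⟨z.arg, u * ‖z‖, ?_⟩
    have hab : a ^ 2 + b ^ 2 = ‖z‖ ^ 2 := by
      rw [← Complex.normSq_eq_norm_sq, Complex.normSq_mk]
      ring
    have e1 : (((a • w₁ + b • w₂).1 : pureQuaternions) : ℍ[ℝ]) =
      a • (w₁.1 : ℍ[ℝ]) + b • (w₂.1 : ℍ[ℝ]) := rfl
    have e2 : (((a • w₁ + b • w₂).2 : pureQuaternions) : ℍ[ℝ]) =
      a • (w₁.2 : ℍ[ℝ]) + b • (w₂.2 : ℍ[ℝ]) := rfl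
    rw [e1, e2, hn, smul_add_smul_mul, hab, smul_add, smul_add, inv_smul_smul₀ (pow_ne_zero 2 hz0),
      smul_smul (‖z‖ ^ 2)⁻¹, smul_smul (‖z‖ ^ 2)⁻¹, Real.cos_two_mul', Real.sin_two_mul]
    have f1 : (‖z‖ ^ 2)⁻¹ * (a ^ 2 - b ^ 2) = Real.cos z.arg ^ 2 - Real.sin z.arg ^ 2 := by
      rw [inv_mul_eq_iff_eq_mul₀ (pow_ne_zero 2 hz0)]
      linear_combination (a + ‖z‖ * Real.cos z.arg) * ha - (b + ‖z‖ * Real.sin z.arg) * hb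
    have f2 : (‖z‖ ^ 2)⁻¹ * (2 * a * b) = 2 * Real.sin z.arg * Real.cos z.arg := by
      rw [inv_mul_eq_iff_eq_mul₀ (pow_ne_zero 2 hz0)]
      linear_combination 2 * b * ha + 2 * ‖z‖ * Real.cos z.arg * hb
    have f3 : a • (w₁.1 : ℍ[ℝ]) + b • (w₂.1 : ℍ[ℝ]) =
        ‖z‖ • (Real.cos z.arg • (w₁.1 : ℍ[ℝ]) + Real.sin z.arg • (w₂.1 : ℍ[ℝ])) := by
      rw [smul_add, smul_smul, smul_smul, ← ha, ← hb]
    rw [f1, f2, f3, smul_smul u]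
  · rintro ⟨t, u, rfl⟩
    have e0 := Real.cos_sq_add_sin_sq t
    refine ⟨Real.cos t • w₁ + Real.sin t • w₂, Submodule.mem_span_pair.mpr ⟨_, _, rfl⟩, ?_,
      mem_lineOfCoords.mpr ⟨u, ?_⟩⟩
    · intro h0
      have := hn (Real.cos t) (Real.sin t)
      rw [e0, show Real.cos t • (w₁.1 : ℍ[ℝ]) + Real.sin t • (w₂.1 : ℍ[ℝ]) = 0 from
        congrArg (fun v => (v.1 : ℍ[ℝ])) h0, map_zero] at this
      exact zero_ne_one this
    · have e1 : (((Real.cos t • w₁ + Real.sin t • w₂).1 : pureQuaternions) : ℍ[ℝ]) =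
        Real.cos t • (w₁.1 : ℍ[ℝ]) + Real.sin t • (w₂.1 : ℍ[ℝ]) := rfl
      have e2 : (((Real.cos t • w₁ + Real.sin t • w₂).2 : pureQuaternions) : ℍ[ℝ]) =
        Real.cos t • (w₁.2 : ℍ[ℝ]) + Real.sin t • (w₂.2 : ℍ[ℝ]) := rfl
      rw [e1, e2, hn, smul_add_smul_mul, e0, inv_one, one_smul, one_smul, Real.cos_two_mul',
        Real.sin_two_mul, mul_right_comm]

theorem theorem4 (ℓ₁ ℓ₂ : OrthLine) (h : ℓ₁.Skew ℓ₂) :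
    (∀ p ∈ joinLine ℓ₁ ℓ₂, ∃! ℓ : OrthLine, ℓ.toProjFive = p) ∧
    IsConoidalSurface (correspondingSet (joinLine ℓ₁ ℓ₂)) pureQuaternions ∧
    HasDimAndDegree (projectiveClosure (correspondingSet (joinLine ℓ₁ ℓ₂))) 2 3 := by
  obtain ⟨w₁, w₂, hspan, h1, h2, h12⟩ := exists_orthonormal_fst (v₁ := ℓ₁.coords) (v₂ := ℓ₂.coords)
    (fun h0 => ℓ₁.dir_ne_zero (congrArg Subtype.val h0))
    fun c hc => h.dir_ne_smul c (congrArg Subtype.val hc)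
  have hjoin : joinLine ℓ₁ ℓ₂ = (Submodule.span ℝ {w₁, w₂}).projectivization := by
    rw [joinLine_eq, hspan]
  have hW : ∀ v ∈ Submodule.span ℝ {w₁, w₂}, v ≠ 0 → v.1 ≠ 0 := by
    intro v hv hv0 h0
    obtain ⟨a, b, rfl⟩ := Submodule.mem_span_pair.mp hv
    have hn := normSq_smul_add_smul (L := w₁.1) (M := w₂.1) h1 h2 h12 a b
    rw [show a • (w₁.1 : ℍ[ℝ]) + b • (w₂.1 : ℍ[ℝ]) = 0 from congrArg Subtype.val h0,
      map_zero] at hn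
    have ha : a = 0 := by nlinarith [sq_nonneg a, sq_nonneg b]
    have hb : b = 0 := by nlinarith [sq_nonneg a, sq_nonneg b]
    simp [ha, hb] at hv0
  have hΓ := correspondingSet_eq_ellipseConoid h1 h2 h12 hW
  have hL := mul_self_of_mem_pureQuaternions w₁.1.2 h1
  have hM := mul_self_of_mem_pureQuaternions w₂.1.2 h2
  have hLM := mul_eq_neg_mul_of_inner_eq_zero w₁.1.2 w₂.1.2 h12
  -- If P were in span(L, M), so would be R; the whole surface, with both given lines, would lie in
  -- the plane through S, against skewness.
  have hind := linearIndependent_of_notMem_span (A := w₁.2) (B := w₂.2) hL hM hLM (by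
    intro hP
    have hR := smul_add_mem_span_of_smul_sub_mem_span hL hM hLM hP
    have key (ℓ : OrthLine) (hℓ : ℓ.toProjFive ∈ joinLine ℓ₁ ℓ₂) (x) (hx : x ∈ ℓ.line) :
        x - (1 / 2 : ℝ) • (w₁.1 * w₁.2 + w₂.1 * w₂.2 : ℍ[ℝ]) ∈
          Submodule.span ℝ {(w₁.1 : ℍ[ℝ]), (w₂.1 : ℍ[ℝ])} := by
      have hxΓ : x ∈ correspondingSet (joinLine ℓ₁ ℓ₂) := ⟨ℓ, hℓ, hx⟩
      rw [hjoin, hΓ] at hxΓ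
      obtain ⟨t, u, rfl⟩ := hxΓ
      rw [add_assoc, add_assoc, add_sub_cancel_left]
      exact add_mem (Submodule.smul_mem _ _ hP) (add_mem (Submodule.smul_mem _ _ hR)
        (Submodule.smul_mem _ _ (add_mem
          (Submodule.smul_mem _ _ (Submodule.subset_span (by simp)))
          (Submodule.smul_mem _ _ (Submodule.subset_span (by simp))))))
    exact h.not_le_mk' _ _ _
      (key ℓ₁ (Projectivization.Subspace.subset_span _ (by simp)))
      (key ℓ₂ (Projectivization.Subspace.subset_span _ (by simp))))
  rw [hjoin, hΓ]
  refine ⟨fun p hp => ?_, isConoidalSurface_ellipseConoid hind w₁.1.2 w₂.1.2,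
    hasDimAndDegree_ellipseConoid _ hind⟩
  induction p with
  | h v hv =>
    exact OrthLine.existsUnique_toProjFive_eq hv
      (hW v ((Submodule.mk_mem_projectivization_iff _ hv).mp hp) hv)
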